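/- Let $(\mathcal T,\Sigma)$ be a triangulated category, let $n\ge 3$ be an integer, and let $\mathcal C$ be an $(n-2)$-cluster tilting subcategory of $\mathcal T$ which is closed under $\widehat\Sigma=\Sigma^{n-2}$. Here a full subcategory $\mathcal C$ of $\mathcal T$ is called $t$-cluster tilting if it is functorially finite in $\mathcal T$ (every object of $\mathcal T$ has a right and a left $\mathcal C$-approximation) and $$\mathcal C=\{A\in\mathcal T\mid \operatorname{Hom}(A,\Sigma^iC)=0\ \text{for all } C\in\mathcal C,\ 1\le i\le t-1\}=\{B\in\mathcal T\mid \operatorname{Hom}(C,\Sigma^iB)=0\ \text{for all } C\in\mathcal C,\ 1\le i\le t-1\}.$$ Consider $(\mathcal C,\widehat\Sigma)$ with the $n$-angulation of Geiss, Keller and Oppermann: its $n$-angles are the sequences $A_1\xrightarrow{\alpha_1}A_2\xrightarrow{\alpha_2}\cdots\xrightarrow{\alpha_{n-1}}A_n\xrightarrow{\alpha_n}\widehat\Sigma A_1$ in $\mathcal C$ for which there are objects $X_1,\dots,X_{n-3}$ of $\mathcal T$ and, with $X_0=A_1$ and $X_{n-2}=A_n$, distinguished triangles $$X_{j-1}\xrightarrow{g_{j-1}}A_{j+1}\xrightarrow{f_j}X_j\xrightarrow{\partial_{n-1-j}}\Sigma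 X_{j-1}\qquad(1\le j\le n-2)$$ in $\mathcal T$ such that $g_0=\alpha_1$, $f_{n-2}=\alpha_{n-1}$, $\alpha_{j+1}=g_j f_j$ for $1\le j\le n-3$, and $\alpha_n=\Sigma^{n-3}\partial_{n-2}\circ\Sigma^{n-4}\partial_{n-3}\circ\cdots\circ\partial_1$. Let $K_0(\mathcal C)$ be the quotient of the free abelian group on the isomorphism classes $\langle A\rangle$ of objects of $\mathcal C$ by the subgroup generated by the elements $\sum_{i=1}^n(-1)^{i+1}\langle A_i\rangle$ for all $n$-angles as above and, if $n$ is even, also by $\langle 0\rangle$; let $K_0(\mathcal T)$ be the Grothendieck group of $\mathcal T$, i.e. the quotient of the free abelian group on the isomorphism classes of objects of $\mathcal T$ by the elements $\langle X\rangle-\langle Y\rangle+\langle Z\rangle$ for all distinguished triangles $X\to Y\to Z\to\Sigma X$. In both groups $[A]$ denotes the class of $\langle A\rangle$. Then $[A]-[B]\mapsto[A]-[B]$ ($A,B\in\mathcal C$) gives a well-defined surjective group homomorphism $K_0(\mathcal C)\to K_0(\mathcal T)$: there is exactly one group homomorphism $K_0(\mathcal C)\to K_0(\mathcal T)$ with $[A]-[B]\mapsto[A]-[B]$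 for all $A,B\in\mathcal C$; it sends $[A]$ to $[A]$ for every $A\in\mathcal C$, and it is surjective. -/

import Mathlib

open CategoryTheory CategoryTheory.Limits CategoryTheory.Pretriangulated

universe v u

section Grothendieck

variable {C : Type u} [Category.{v} C]

/-- An `n`-`S`-sequence `A₁ ⟶ A₂ ⟶ ⋯ ⟶ Aₙ ⟶ S A₁` in a category `C` with an endofunctor `S`
(for `n ≥ 1`): the chain `A₁ ⟶ ⋯ ⟶ Aₙ` consists of `n - 1` composable arrows, and `conn` is the
last morphism `Aₙ ⟶ S A₁`. -/
structure NSigmaSequence (C : Type u) [Category.{v} C] (S : C ⥤ C) (n : ℕ) where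
  arrows : ComposableArrows C (n - 1)
  conn : arrows.right ⟶ S.obj arrows.left

/-- The generator `⟨A⟩` of the free abelian group on the set of isomorphism classes of objects. -/
def isoClassGen (A : C) : FreeAbelianGroup (Quotient (isIsomorphicSetoid C)) :=
  FreeAbelianGroup.of (Quotient.mk (isIsomorphicSetoid C) A)

/-- The Euler relation `⟨A₁⟩ - ⟨A₂⟩ + ⟨A₃⟩ - ⋯ + (-1)ⁿ⁺¹ ⟨Aₙ⟩` of an `n`-`S`-sequence. -/
def NSigmaSequence.euler {S : C ⥤ C} {n : ℕ} (A : NSigmaSequence C S n) :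
    FreeAbelianGroup (Quotient (isIsomorphicSetoid C)) :=
  ∑ i : Fin (n - 1 + 1), (-1 : ℤ) ^ (i : ℕ) • isoClassGen (A.arrows.obj i)

/-- The relations defining the Grothendieck group: the Euler relations of the sequences in `N`
(the `n`-angles) and, for even `n`, the class `⟨0⟩`. -/
def grothendieckRelations {S : C ⥤ C} {n : ℕ} (N : Set (NSigmaSequence C S n)) :
    AddSubgroup (FreeAbelianGroup (Quotient (isIsomorphicSetoid C))) :=
  AddSubgroup.closure
    ({x | ∃ A ∈ N, x = A.euler} ∪ {x | Even n ∧ ∃ Z : C, IsZero Z ∧ x = isoClassGen Z})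

/-- The Grothendieck group of the category `C` with the collection `N` of `n`-angles. -/
abbrev GrothendieckGroup {S : C ⥤ C} {n : ℕ} (N : Set (NSigmaSequence C S n)) : Type u :=
  FreeAbelianGroup (Quotient (isIsomorphicSetoid C)) ⧸ grothendieckRelations N

/-- The class `[A]` of an object in the Grothendieck group. -/
def grothendieckClass {S : C ⥤ C} {n : ℕ} (N : Set (NSigmaSequence C S n)) (A : C) :
    GrothendieckGroup N :=
  QuotientAddGroup.mk (isoClassGen A)

end Grothendieck

section Triangulated

variable {T : Type u} [Category.{v} T] [Preadditive T] [HasZeroObject T] [HasShift T ℤ]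
  [∀ k : ℤ, (shiftFunctor T k).Additive] [Pretriangulated T]

variable (T) in
/-- The collection of `3`-angles of a triangulated category: its distinguished triangles. -/
def distTriangles : Set (NSigmaSequence T (shiftFunctor T (1 : ℤ)) 3) :=
  {A | Triangle.mk (A.arrows.map' 0 1) (A.arrows.map' 1 2) A.conn ∈ distTriang T}

/-- Every object of `T` admits a right `P`-approximation (`P` is contravariantly finite). -/
def IsContravariantlyFinite (P : ObjectProperty T) : Prop :=
  ∀ X : T, ∃ (A : T) (f : A ⟶ X), P A ∧ ∀ (A' : T) (g : A' ⟶ X), P A' → ∃ h : A' ⟶ A, h ≫ f = g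

/-- Every object of `T` admits a left `P`-approximation (`P` is covariantly finite). -/
def IsCovariantlyFinite (P : ObjectProperty T) : Prop :=
  ∀ X : T, ∃ (A : T) (f : X ⟶ A), P A ∧ ∀ (A' : T) (g : X ⟶ A'), P A' → ∃ h : A ⟶ A', f ≫ h = g

/-- The full subcategory `P` is `t`-cluster tilting: it is functorially finite, it consists of the
objects `A` with `Hom(A, Σⁱ C) = 0` for all `C` in `P` and `1 ≤ i ≤ t - 1`, and it consists of the
objects `B` with `Hom(C, Σⁱ B) = 0` for all `C` in `P` and `1 ≤ i ≤ t - 1`. -/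
structure IsClusterTilting (P : ObjectProperty T) (t : ℕ) : Prop where
  contravariantlyFinite : IsContravariantlyFinite P
  covariantlyFinite : IsCovariantlyFinite P
  mem_iff_hom_to (A : T) :
    P A ↔ ∀ (C : T) (i : ℕ), P C → 1 ≤ i → i ≤ t - 1 → ∀ f : A ⟶ C⟦(i : ℤ)⟧, f = 0
  mem_iff_hom_from (B : T) :
    P B ↔ ∀ (C : T) (i : ℕ), P C → 1 ≤ i → i ≤ t - 1 → ∀ f : C ⟶ B⟦(i : ℤ)⟧, f = 0

/-- If `P` is closed under `Σᵗ`, the condition `Hom(C, Σⁱ B) = 0` for `1 ≤ i ≤ t - 1` and all `C` in `P`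
is the same as the condition `Hom(Σⁱ C, B) = 0` for `1 ≤ i ≤ t - 1` and all `C` in `P`, so that
either of them may be used in the definition of a cluster tilting subcategory. -/
theorem hom_from_iff_negative (P : ObjectProperty T) (t : ℕ)
    (h : ∀ A : T, P A ↔ ∀ (C : T) (i : ℕ), P C → 1 ≤ i → i ≤ t - 1 →
      ∀ f : A ⟶ C⟦(i : ℤ)⟧, f = 0)
    (hP : ∀ A : T, P A → P (A⟦(t : ℤ)⟧)) (B : T) :
    (∀ (C : T) (i : ℕ), P C → 1 ≤ i → i ≤ t - 1 → ∀ f : C ⟶ B⟦(i : ℤ)⟧, f = 0) ↔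
      ∀ (C : T) (i : ℕ), P C → 1 ≤ i → i ≤ t - 1 → ∀ f : C⟦(i : ℤ)⟧ ⟶ B, f = 0 := by
  constructor
  · intro H C i hC h1 h2 f
    have hj : (i : ℤ) + ((t - i : ℕ) : ℤ) = t := by omega
    have := H _ (t - i) (hP C hC) (by omega) (by omega)
      ((shiftFunctorAdd' T _ _ _ hj).hom.app C ≫ f⟦((t - i : ℕ) : ℤ)⟧')
    have h3 := (Preadditive.IsIso.comp_left_eq_zero _ _).1 this
    exact (shiftFunctor T ((t - i : ℕ) : ℤ)).map_injective (by simpa using h3)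
  · intro H C i hC h1 h2 f
    have hC' : P (C⟦-(t : ℤ)⟧) := by
      rw [h]
      intro D j hD hj1 hj2 g
      have e1 : -(t : ℤ) + t = 0 := by omega
      have e2 : (j : ℤ) + t = t + j := by omega
      have := (h C).1 hC _ j (hP D hD) hj1 hj2
        ((shiftFunctorCompIsoId T _ _ e1).inv.app C ≫ g⟦(t : ℤ)⟧' ≫
          (shiftFunctorComm T (j : ℤ) (t : ℤ)).hom.app D)
      have h3 := (Preadditive.IsIso.comp_left_eq_zero _ _).1 this
      have h4 := (Preadditive.IsIso.comp_right_eq_zero _ _).1 h3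
      exact (shiftFunctor T (t : ℤ)).map_injective (by simpa using h4)
    have e3 : -(t : ℤ) + ((t - i : ℕ) : ℤ) = -(i : ℤ) := by omega
    have e4 : (i : ℤ) + -(i : ℤ) = 0 := by omega
    have := H _ (t - i) hC' (by omega) (by omega)
      ((shiftFunctorAdd' T _ _ _ e3).inv.app C ≫ f⟦-(i : ℤ)⟧' ≫
          (shiftFunctorCompIsoId T _ _ e4).hom.app B)
    have h3 := (Preadditive.IsIso.comp_left_eq_zero _ _).1 this
    have h4 := (Preadditive.IsIso.comp_right_eq_zero _ _).1 h3
    exact (shiftFunctor T (-(i : ℤ))).map_injective (by simpa using h4)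

/-- The sequence `A₁ ⟶ ⋯ ⟶ Aₙ ⟶ Σⁿ⁻² A₁` in `T` is spliced together from `n - 2` distinguished
triangles, as in the diagram
```
       A₂ ────────> A₃ ────> ⋯ ───> Aₙ₋₁
      ↗  ↘ f₁   g₁ ↗  ↘            ↗    ↘
    A₁ <─+─ X₁ ────┘    X₂ <─+─ ⋯ Xₙ₋₃ <─+─ Aₙ
```
where `+` marks a morphism of degree one. For `n = 3` the sequence is a distinguished triangle.
For `n ≥ 4` the first triangle is `A₁ ⟶ A₂ ⟶ X ⟶ Σ A₁` with last morphism `d`, the morphism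
`A₂ ⟶ A₃` is the composite of `f : A₂ ⟶ X` and `g : X ⟶ A₃`, the remaining sequence
`X ⟶ A₃ ⟶ ⋯ ⟶ Aₙ ⟶ Σⁿ⁻³ X` with first morphism `g` and last morphism `e` is spliced from `n - 3`
triangles, and `Aₙ ⟶ Σⁿ⁻² A₁` is `Σⁿ⁻³ d` after `e`. -/
def IsSpliced : (n : ℕ) → NSigmaSequence T (shiftFunctor T ((n - 2 : ℕ) : ℤ)) n → Prop
  | 0, _ => False
  | 1, _ => False
  | 2, _ => False
  | 3, A => A ∈ distTriangles T
  | m + 4, A =>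
    ∃ (X : T) (f : A.arrows.obj' 1 ⟶ X) (g : X ⟶ A.arrows.obj' 2)
      (d : X ⟶ (A.arrows.obj' 0)⟦(1 : ℤ)⟧)
      (e : A.arrows.right ⟶ X⟦((m + 1 : ℕ) : ℤ)⟧),
      Triangle.mk (A.arrows.map' 0 1) f d ∈ distTriang T ∧
      f ≫ g = A.arrows.map' 1 2 ∧
      A.conn = e ≫ d⟦((m + 1 : ℕ) : ℤ)⟧' ≫
        (shiftFunctorAdd' T (1 : ℤ) ((m + 1 : ℕ) : ℤ) ((m + 2 : ℕ) : ℤ)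
          (by push_cast; ring)).inv.app (A.arrows.obj' 0) ∧
      IsSpliced (m + 3) ⟨ComposableArrows.precomp (n := m + 1) A.arrows.δ₀.δ₀ g, e⟩

/-- The endofunctor `Σᵗ` of a full subcategory `P` which is closed under `Σᵗ`. -/
abbrev sigmaHat (P : ObjectProperty T) (t : ℕ) (hP : ∀ A : T, P A → P (A⟦(t : ℤ)⟧)) :
    P.FullSubcategory ⥤ P.FullSubcategory :=
  P.lift (P.ι ⋙ shiftFunctor T (t : ℤ)) (fun A => hP A.obj A.property)

/-- The `n`-angles of the category `(P, Σⁿ⁻²)`: the sequences with all `Aᵢ` in `P` that are spliced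
together from `n - 2` distinguished triangles of `T`. -/
def clusterAngles (P : ObjectProperty T) (n : ℕ)
    (hP : ∀ A : T, P A → P (A⟦((n - 2 : ℕ) : ℤ)⟧)) :
    Set (NSigmaSequence P.FullSubcategory (sigmaHat P (n - 2) hP) n) :=
  {A | IsSpliced n ⟨(P.ι.mapComposableArrows (n - 1)).obj A.arrows, P.ι.map A.conn⟩}

/-- The Grothendieck group of a triangulated category: the case `n = 3`. -/
abbrev triangulatedK₀ (T : Type u) [Category.{v} T] [Preadditive T] [HasZeroObject T]
    [HasShift T ℤ] [∀ k : ℤ, (shiftFunctor T k).Additive] [Pretriangulated T] : Type u :=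
  GrothendieckGroup (distTriangles T)

end Triangulated

open ZeroObject

/-! ### Generators and relations -/

section Grothendieck

variable {C : Type u} [Category.{v} C]

/-! The inclusion of the cluster tilting subcategory respects the relations: the Euler relation of a
spliced sequence is an alternating sum of those of its triangles, the classes of the intermediate
objects cancelling (`IsSpliced.euler_mem`).

For surjectivity, complete a right approximation `A ⟶ X` to a triangle `Y ⟶ A ⟶ X ⟶ Y⟦1⟧`. Then `[X]
= [A] - [Y]`, and the vanishing range of `Hom(C, Y⟦j⟧)` is one degree longer than that for `X`
(`hom_shift_eq_zero_of_approximation`). Iterating, the range becomes complete and the last object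
lies in the subcategory.

Uniqueness reduces differences to single classes: `[0] = 0` in the source, and the classes `[A]`
generate it. -/

theorem isoClassGen_eq_of_iso {A B : C} (e : A ≅ B) : isoClassGen A = isoClassGen B :=
  congrArg FreeAbelianGroup.of (Quotient.sound ⟨e⟩)

/-- The homomorphism induced by a functor on the free abelian groups on isomorphism classes. -/
def isoClassMap {D : Type*} [Category* D] (F : C ⥤ D) :
    FreeAbelianGroup (Quotient (isIsomorphicSetoid C)) →+
      FreeAbelianGroup (Quotient (isIsomorphicSetoid D)) :=
  FreeAbelianGroup.map (Quotient.map F.obj fun _ _ ⟨e⟩ => ⟨F.mapIso e⟩)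

@[simp]
theorem isoClassMap_isoClassGen {D : Type*} [Category* D] (F : C ⥤ D) (A : C) :
    isoClassMap F (isoClassGen A) = isoClassGen (F.obj A) := by
  simp [isoClassMap, isoClassGen]

variable {S : C ⥤ C} {n : ℕ} (N : Set (NSigmaSequence C S n))

theorem euler_mem_grothendieckRelations {A : NSigmaSequence C S n} (hA : A ∈ N) :
    A.euler ∈ grothendieckRelations N :=
  AddSubgroup.subset_closure (Or.inl ⟨A, hA, rfl⟩)

theorem grothendieckClass_induction {p : GrothendieckGroup N → Prop} (zero : p 0)
    (of : ∀ A, p (grothendieckClass N A)) (neg : ∀ x, p x → p (-x))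
    (add : ∀ x y, p x → p y → p (x + y)) (x : GrothendieckGroup N) : p x := by
  obtain ⟨x, rfl⟩ := QuotientAddGroup.mk_surjective x
  induction x using FreeAbelianGroup.induction_on with
  | zero => exact zero
  | of a => exact Quotient.inductionOn a of
  | neg a h => exact neg _ h
  | add a b ha hb => exact add _ _ ha hb

end Grothendieck

section ObjectProperty

variable {T : Type u} [Category.{v} T] [Preadditive T] {P : ObjectProperty T}

theorem isZero_obj_of_isZero {Z : P.FullSubcategory} (hZ : IsZero Z) : IsZero Z.obj :=
  (IsZero.iff_id_eq_zero _).2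
    (congrArg P.ι.map (hZ.eq_of_src (𝟙 Z) (P.homMk 0)))

theorem IsClusterTilting.prop_of_isZero [HasShift T ℤ] {t : ℕ} (hP : IsClusterTilting P t)
    {Z : T} (hZ : IsZero Z) : P Z :=
  (hP.mem_iff_hom_to Z).2 fun _ _ _ _ _ _ => hZ.eq_of_src _ _

end ObjectProperty

/-! ### Spliced sequences and relations in `K₀(T)` -/

section Triangulated

variable {T : Type u} [Category.{v} T] [Preadditive T] [HasZeroObject T] [HasShift T ℤ]
  [∀ k : ℤ, (shiftFunctor T k).Additive] [Pretriangulated T]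

theorem isoClassGen_distinguished {X Y Z : T} {f : X ⟶ Y} {g : Y ⟶ Z} {h : Z ⟶ X⟦(1 : ℤ)⟧}
    (H : Triangle.mk f g h ∈ distTriang T) :
    isoClassGen X - isoClassGen Y + isoClassGen Z ∈ grothendieckRelations (distTriangles T) := by
  have := euler_mem_grothendieckRelations (distTriangles T)
    (A := ⟨ComposableArrows.mk₂ f g, h⟩) H
  have e : NSigmaSequence.euler (⟨ComposableArrows.mk₂ f g, h⟩ :
      NSigmaSequence T (shiftFunctor T (1 : ℤ)) 3) =
      isoClassGen X - isoClassGen Y + isoClassGen Z := by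
    refine (Fin.sum_univ_three _).trans ?_
    simp only [Fin.val_zero, Fin.val_one, Fin.val_two, pow_zero, pow_one, one_smul, neg_smul,
      even_two, Even.neg_pow, one_pow, sub_eq_add_neg]
    rfl
  rwa [e] at this

theorem grothendieckClass_distinguished {X Y Z : T} {f : X ⟶ Y} {g : Y ⟶ Z}
    {h : Z ⟶ X⟦(1 : ℤ)⟧} (H : Triangle.mk f g h ∈ distTriang T) :
    grothendieckClass (distTriangles T) Z =
      grothendieckClass (distTriangles T) Y - grothendieckClass (distTriangles T) X := by
  have h0 := (QuotientAddGroup.eq_zero_iff _).2 (isoClassGen_distinguished H)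
  change grothendieckClass (distTriangles T) X - grothendieckClass (distTriangles T) Y +
    grothendieckClass (distTriangles T) Z = 0 at h0
  rw [eq_sub_iff_add_eq, ← sub_eq_zero, ← h0]
  abel

theorem isoClassGen_mem_of_isZero {Z : T} (hZ : IsZero Z) :
    isoClassGen Z ∈ grothendieckRelations (distTriangles T) := by
  have := isoClassGen_distinguished (contractible_distinguished Z)
  rw [isoClassGen_eq_of_iso hZ.isoZero]
  -- The triangle `Z ⟶ Z ⟶ 0` has Euler relation `⟨0⟩`.
  simpa [isoClassGen_eq_of_iso hZ.isoZero] using this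

/-- The Euler relation of a spliced sequence holds in the Grothendieck group of `T`. -/
theorem IsSpliced.euler_mem : ∀ {n : ℕ}
    {A : NSigmaSequence T (shiftFunctor T ((n - 2 : ℕ) : ℤ)) n},
    IsSpliced n A → A.euler ∈ grothendieckRelations (distTriangles T)
  | 0, _, h => h.elim
  | 1, _, h => h.elim
  | 2, _, h => h.elim
  | 3, _, h => euler_mem_grothendieckRelations (distTriangles T) h
  | m + 4, A, h => by
    obtain ⟨X, f, g, d, e, hd, -, -, hs⟩ := h
    have h1 := isoClassGen_distinguished hd
    have h2 := IsSpliced.euler_mem hs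
    -- `⟨X⟩` cancels; the later terms sit one place earlier in the remaining sequence, so their
    -- signs flip and its relation is subtracted.
    have e1 : A.euler = (isoClassGen (A.arrows.obj' 0) - isoClassGen (A.arrows.obj' 1) +
        isoClassGen X) - NSigmaSequence.euler (S := shiftFunctor T ((m + 3 - 2 : ℕ) : ℤ))
          (n := m + 3) ⟨ComposableArrows.precomp (n := m + 1) A.arrows.δ₀.δ₀ g, e⟩ := by
      have e2 : NSigmaSequence.euler (S := shiftFunctor T ((m + 3 - 2 : ℕ) : ℤ))
          (n := m + 3) ⟨ComposableArrows.precomp (n := m + 1) A.arrows.δ₀.δ₀ g, e⟩ =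
          isoClassGen X + ∑ i : Fin (m + 2), (-1 : ℤ) ^ ((i : ℕ) + 1) •
            isoClassGen (A.arrows.obj i.succ.succ) := by
        refine (Fin.sum_univ_succ (n := m + 2) _).trans ?_
        congr 1
      have e3 : A.euler = isoClassGen (A.arrows.obj' 0) + (- isoClassGen (A.arrows.obj' 1) +
          ∑ i : Fin (m + 2), (-1 : ℤ) ^ ((i : ℕ) + 1 + 1) •
            isoClassGen (A.arrows.obj i.succ.succ)) := by
        refine (Fin.sum_univ_succ (n := m + 3) _).trans ?_
        congr 1
        refine (Fin.sum_univ_succ (n := m + 2) _).trans ?_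
        congr 1
      rw [e2, e3]
      simp only [pow_succ _ (_ + 1), mul_neg_one, neg_smul, Finset.sum_neg_distrib]
      abel
    rw [e1]
    exact sub_mem h1 h2

theorem distinguished_of_isZero {X Y Z : T} (f : X ⟶ Y) (g : Y ⟶ Z) (h : Z ⟶ X⟦(1 : ℤ)⟧)
    (hX : IsZero X) (hY : IsZero Y) (hZ : IsZero Z) : Triangle.mk f g h ∈ distTriang T :=
  isomorphic_distinguished _ (contractible_distinguished (0 : T)) _
    (Triangle.isoMk _ _ hX.isoZero hY.isoZero (hZ.iso (isZero_zero T))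
      (hX.eq_of_src _ _) (hY.eq_of_src _ _) (hZ.eq_of_src _ _))

/-- Every sequence of zero objects is spliced. -/
theorem isSpliced_of_isZero : ∀ {n : ℕ} (_ : 3 ≤ n)
    (A : NSigmaSequence T (shiftFunctor T ((n - 2 : ℕ) : ℤ)) n)
    (_ : ∀ i, IsZero (A.arrows.obj i)), IsSpliced n A
  | 0, hn, _, _ => by omega
  | 1, hn, _, _ => by omega
  | 2, hn, _, _ => by omega
  | 3, _, _, hA => distinguished_of_isZero _ _ _ (hA _) (hA _) (hA _)
  | m + 4, _, A, hA => by
    refine ⟨0, 0, 0, 0, 0, distinguished_of_isZero _ _ _ (hA _) (hA _) (isZero_zero T),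
      (hA _).eq_of_src _ _, (hA _).eq_of_src _ _, isSpliced_of_isZero (by omega) _ ?_⟩
    exact Fin.cases (isZero_zero T) fun i => hA _

/-! ### The induced homomorphism -/

section ClusterTilting

variable {P : ObjectProperty T}

variable (n : ℕ) (hclosed : ∀ A : T, P A → P (A⟦((n - 2 : ℕ) : ℤ)⟧))

theorem grothendieckRelations_clusterAngles_le :
    grothendieckRelations (clusterAngles P n hclosed) ≤
      (grothendieckRelations (distTriangles T)).comap (isoClassMap P.ι) := by
  refine (AddSubgroup.closure_le _).2 ?_
  rintro x (⟨A, hA, rfl⟩ | ⟨-, Z, hZ, rfl⟩)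
  · have e : isoClassMap P.ι A.euler = NSigmaSequence.euler
        (S := shiftFunctor T ((n - 2 : ℕ) : ℤ))
        ⟨(P.ι.mapComposableArrows (n - 1)).obj A.arrows, P.ι.map A.conn⟩ := by
      simp only [NSigmaSequence.euler, map_sum, map_zsmul, isoClassMap_isoClassGen]
      rfl
    change isoClassMap P.ι A.euler ∈ grothendieckRelations (distTriangles T)
    rw [e]
    exact IsSpliced.euler_mem hA
  · change isoClassMap P.ι (isoClassGen Z) ∈ grothendieckRelations (distTriangles T)
    rw [isoClassMap_isoClassGen]
    exact isoClassGen_mem_of_isZero (isZero_obj_of_isZero hZ)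

/-- The homomorphism `[A] ↦ [A]` from the Grothendieck group of `(P, Σⁿ⁻²)` to that of `T`. -/
def clusterK₀Map : GrothendieckGroup (clusterAngles P n hclosed) →+ triangulatedK₀ T :=
  QuotientAddGroup.map _ _ (isoClassMap P.ι) (grothendieckRelations_clusterAngles_le n hclosed)

theorem clusterK₀Map_class (A : P.FullSubcategory) :
    clusterK₀Map n hclosed (grothendieckClass (clusterAngles P n hclosed) A) =
      grothendieckClass (distTriangles T) A.obj :=
  congrArg QuotientAddGroup.mk (isoClassMap_isoClassGen P.ι A)

/-- For even `n` this is an imposed relation; for odd `n` the constant sequence at `Z` is an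
`n`-angle whose alternating sum leaves one copy of `⟨Z⟩`. -/
theorem grothendieckClass_clusterAngles_of_isZero (hn : 3 ≤ n) {Z : P.FullSubcategory}
    (hZ : IsZero Z.obj) : grothendieckClass (clusterAngles P n hclosed) Z = 0 := by
  have hZ' : IsZero Z := hZ.of_full_of_faithful_of_isZero P.ι Z
  refine (QuotientAddGroup.eq_zero_iff _).2 ?_
  obtain he | ho := Nat.even_or_odd n
  · exact AddSubgroup.subset_closure (Or.inr ⟨he, Z, hZ', rfl⟩)
  · let A : NSigmaSequence P.FullSubcategory (sigmaHat P (n - 2) hclosed) n :=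
      ⟨(Functor.const _).obj Z, hZ'.to_ _⟩
    have hA : A ∈ clusterAngles P n hclosed := isSpliced_of_isZero hn _ fun _ => hZ
    have e : A.euler = isoClassGen Z := by
      have : Odd (n - 1 + 1) := by rwa [Nat.sub_add_cancel (by omega)]
      calc A.euler = ∑ i : Fin (n - 1 + 1), (-1 : ℤ) ^ (i : ℕ) • isoClassGen Z := rfl
        _ = isoClassGen Z := by
          rw [← Finset.sum_smul, Fin.sum_univ_eq_sum_range (fun i => (-1 : ℤ) ^ i),
            neg_one_geom_sum, if_neg (Nat.not_even_iff_odd.2 this), one_smul]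
    exact e ▸ euler_mem_grothendieckRelations _ hA

/-! ### Surjectivity by iterated approximation -/

/-- The kernel of a right approximation has one more vanishing positive self-extension. -/
theorem hom_shift_eq_zero_of_approximation {X Y A C : T} {f : Y ⟶ A} {g : A ⟶ X}
    {h : X ⟶ Y⟦(1 : ℤ)⟧} (H : Triangle.mk f g h ∈ distTriang T) (j : ℕ)
    (hA : ∀ q : C ⟶ A⟦((j + 1 : ℕ) : ℤ)⟧, q = 0)
    (hX : ∀ q : C ⟶ X⟦(j : ℤ)⟧, ∃ r : C ⟶ A⟦(j : ℤ)⟧, r ≫ g⟦(j : ℤ)⟧' = q)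
    (q : C ⟶ Y⟦((j + 1 : ℕ) : ℤ)⟧) : q = 0 := by
  have s : Triangle.mk ((j : ℤ).negOnePow • f⟦(j : ℤ)⟧') ((j : ℤ).negOnePow • g⟦(j : ℤ)⟧')
      ((j : ℤ).negOnePow • h⟦(j : ℤ)⟧' ≫ (shiftFunctorComm T 1 (j : ℤ)).hom.app Y) ∈
      distTriang T := Triangle.shift_distinguished _ H (j : ℤ)
  -- Only exactness matters from here on, so the sign of the connecting morphism can be forgotten.
  generalize (j : ℤ).negOnePow • h⟦(j : ℤ)⟧' ≫ (shiftFunctorComm T 1 (j : ℤ)).hom.app Y = d at s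
  have h₂ : ((j : ℤ).negOnePow • g⟦(j : ℤ)⟧') ≫ d = 0 := comp_distTriang_mor_zero₂₃ _ s
  rw [Linear.units_smul_comp, smul_eq_zero_iff_eq] at h₂
  let a := shiftFunctorAdd' T (j : ℤ) 1 ((j + 1 : ℕ) : ℤ) (by push_cast; rfl)
  obtain ⟨q', hq'⟩ : ∃ q' : C ⟶ (Y⟦(j : ℤ)⟧)⟦(1 : ℤ)⟧, q' = q ≫ a.hom.app Y := ⟨_, rfl⟩
  have hs : q' ≫ (f⟦(j : ℤ)⟧')⟦(1 : ℤ)⟧' = 0 := by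
    have := a.hom.naturality f
    dsimp at this
    rw [hq', Category.assoc, ← this, ← Category.assoc, hA (q ≫ _), zero_comp]
  obtain ⟨r, hr⟩ : ∃ r : C ⟶ X⟦(j : ℤ)⟧, q' = r ≫ d := Triangle.coyoneda_exact₁ _ s q' (by
    change q' ≫ ((j : ℤ).negOnePow • f⟦(j : ℤ)⟧')⟦(1 : ℤ)⟧' = 0
    rw [Functor.map_units_smul, Linear.comp_units_smul, hs, smul_zero])
  -- Since `r` lifts along `g⟦j⟧`, its composite with the connecting morphism vanishes.
  obtain ⟨p, rfl⟩ := hX r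
  rw [Category.assoc, h₂, comp_zero, hq'] at hr
  exact (Preadditive.IsIso.comp_right_eq_zero _ _).1 hr

/-- If all but `k` of the required extension groups vanish, then the class of `X` is a combination
of classes of objects of the cluster tilting subcategory. -/
theorem IsClusterTilting.grothendieckClass_mem_range (hP : IsClusterTilting P (n - 2)) :
    ∀ (k : ℕ) (X : T), (∀ (C : T) (j : ℕ), P C → 1 ≤ j → j + k + 1 ≤ n - 2 →
      ∀ q : C ⟶ X⟦(j : ℤ)⟧, q = 0) →
      grothendieckClass (distTriangles T) X ∈ (clusterK₀Map n hclosed).range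
  | 0, X, hX => by
    have : P X := (hP.mem_iff_hom_from X).2 fun C j hC h₁ h₂ =>
      hX C j hC h₁ (by omega)
    exact ⟨_, clusterK₀Map_class n hclosed ⟨X, this⟩⟩
  | k + 1, X, hX => by
    obtain ⟨A, g, hA, hg⟩ := hP.contravariantlyFinite X
    obtain ⟨Y, f, h, H⟩ := distinguished_cocone_triangle₁ g
    have hY := hP.grothendieckClass_mem_range k Y fun C j hC h₁ h₂ => by
      obtain ⟨i, rfl⟩ := Nat.exists_eq_add_of_le' h₁
      refine hom_shift_eq_zero_of_approximation H i
        ((hP.mem_iff_hom_from A).1 hA C (i + 1) hC h₁ (by omega)) fun q => ?_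
      -- In degree `0` the lift is the approximation property; in positive degrees the morphism to
      -- lift is already zero.
      obtain rfl | hi := Nat.eq_zero_or_pos i
      · let e := shiftFunctorZero T ℤ
        obtain ⟨p, hp⟩ := hg C (q ≫ e.hom.app X) hC
        refine ⟨p ≫ e.inv.app A, ?_⟩
        have := e.inv.naturality g
        dsimp at this
        change (p ≫ e.inv.app A) ≫ g⟦(0 : ℤ)⟧' = q
        rw [Category.assoc, ← this, reassoc_of% hp, Iso.hom_inv_id_app]
        exact Category.comp_id q
      · exact ⟨0, by rw [zero_comp, hX C i hC hi (by omega) q]⟩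
    rw [grothendieckClass_distinguished H]
    exact sub_mem ⟨_, clusterK₀Map_class n hclosed ⟨A, hA⟩⟩ hY

theorem IsClusterTilting.clusterK₀Map_surjective (hP : IsClusterTilting P (n - 2)) :
    Function.Surjective (clusterK₀Map n hclosed) := by
  rw [← AddMonoidHom.range_eq_top, eq_top_iff]
  intro x _
  induction x using grothendieckClass_induction with
  | zero => exact zero_mem _
  | of X =>
    -- For `k = n - 2` no degree `j` is constrained, so every object qualifies.
    exact hP.grothendieckClass_mem_range n hclosed (n - 2) X fun C j _ h₁ h₂ => by omega
  | neg x h => exact neg_mem (h trivial)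
  | add x y hx hy => exact add_mem (hx trivial) (hy trivial)

end ClusterTilting

end Triangulated

theorem mainTheorem5 {T : Type u} [Category.{v} T] [Preadditive T] [HasZeroObject T]
    [HasShift T ℤ] [∀ k : ℤ, (shiftFunctor T k).Additive] [Pretriangulated T] [IsTriangulated T]
    (n : ℕ) (hn : 3 ≤ n) (P : ObjectProperty T) (hP : IsClusterTilting P (n - 2))
    (hclosed : ∀ A : T, P A → P (A⟦((n - 2 : ℕ) : ℤ)⟧)) :
    ∃ φ : GrothendieckGroup (clusterAngles P n hclosed) →+ triangulatedK₀ T,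
      (∀ A B : P.FullSubcategory,
        φ (grothendieckClass (clusterAngles P n hclosed) A -
            grothendieckClass (clusterAngles P n hclosed) B) =
          grothendieckClass (distTriangles T) A.obj -
            grothendieckClass (distTriangles T) B.obj) ∧
      (∀ A : P.FullSubcategory,
        φ (grothendieckClass (clusterAngles P n hclosed) A) =
          grothendieckClass (distTriangles T) A.obj) ∧
      (∀ ψ : GrothendieckGroup (clusterAngles P n hclosed) →+ triangulatedK₀ T,
        (∀ A B : P.FullSubcategory,
          ψ (grothendieckClass (clusterAngles P n hclosed) A -
              grothendieckClass (clusterAngles P n hclosed) B) =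
            grothendieckClass (distTriangles T) A.obj -
              grothendieckClass (distTriangles T) B.obj) → ψ = φ) ∧
      Function.Surjective φ := by
  refine ⟨clusterK₀Map n hclosed, fun A B => ?_, clusterK₀Map_class n hclosed, fun ψ hψ => ?_,
    hP.clusterK₀Map_surjective n hclosed⟩
  · rw [map_sub, clusterK₀Map_class, clusterK₀Map_class]
  · refine DFunLike.ext _ _ fun x => ?_
    induction x using grothendieckClass_induction with
    | zero => rw [map_zero, map_zero]
    | of A =>
      -- Comparing with a zero object turns the condition on differences into one on `[A]`.
      let Z : P.FullSubcategory := ⟨0, hP.prop_of_isZero (isZero_zero T)⟩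
      have h := hψ A Z
      have hZ := grothendieckClass_clusterAngles_of_isZero n hclosed hn (Z := Z) (isZero_zero T)
      rw [hZ, sub_zero, ← clusterK₀Map_class n hclosed, ← clusterK₀Map_class n hclosed, hZ,
        map_zero, sub_zero] at h
      exact h
    | neg x h => rw [map_neg, map_neg, h]
    | add x y hx hy => rw [map_add, map_add, hx, hy]
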